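/- Consider the two-user binary intermittent interference channel with erasure probabilities $0\le\delta_{ij}\le 1$, $i,j\in\{1,2\}$. At time $t=1,\dots,n$ receiver $i$ observes $Y_i[t]=S_{ii}[t]X_i[t]\oplus S_{\bar i i}[t]X_{\bar i}[t]$, $\bar i=3-i$, where $X_i[t]\in\{0,1\}$ is the signal of transmitter $i$, $\oplus$ is addition modulo $2$, and the link states $S_{ij}[t]$ (from transmitter $i$ to receiver $j$) are independent over links and time with $S_{ij}[t]\sim\mathrm{Bernoulli}(1-\delta_{ij})$. The messages $W_1,W_2$ are independent of each other and of the link states, and $W_i$ is uniform on the integers in $[1,2^{n\lambda_i}]$. A code of block length $n$ consists of encoders $X_i[t]=f_{i,t}(W_i,S^{t-1})$, where $S^{t-1}$ is the list of the states of all four links at times $1,\dots,t-1$ (unit-delayed channel state information), and decoders $\hat W_i=g_i(Y_i^n,S^n)$. A pair of rates $\lambda_1,\lambda_2\ge 0$ is achievable if there is a sequence of codes, one for each block length $n$, with $\Pr[\hat W_i\ne W_i]\to 0$ as $n\to\infty$ for $i=1,2$; the capacity region $\mathcal C$ is the closure of the set of achievable pairs. Then $\mathcal C\subseteq\bar{\mathcal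 C}$, where $\bar{\mathcal C}$ is the set of all pairs $(\hat\lambda_1,\hat\lambda_2)$ such that $$0\le\hat\lambda_i\le 1-\delta_{ii},\qquad i=1,2,$$ and, for each $i\in\{1,2\}$ with $\delta_{i\bar i}<1$, $$\hat\lambda_i+\frac{1-\delta_{ii}\delta_{i\bar i}}{1-\delta_{i\bar i}}\,\hat\lambda_{\bar i}\le\frac{(1-\delta_{ii}\delta_{i\bar i})(1-\delta_{\bar i\bar i}\delta_{i\bar i})}{1-\delta_{i\bar i}}.$$ -/

import Mathlib

open Filter Topology

namespace IntermittentIC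

/-- The index of the other user: `ī = 3 - i` when the users are called 1 and 2. -/
def other (i : Fin 2) : Fin 2 := 1 - i

/-- The states of the four links at one time instant: `s i j` is `true` if and only if the link
from transmitter `i` to receiver `j` is on. -/
abbrev LinkState : Type := Fin 2 → Fin 2 → Bool

/-- Probability of a sequence of link states over `n` time instants, when all the links are
independent of each other and over time, and the link from transmitter `i` to receiver `j` is
on with probability `1 - δ i j` at each time instant. -/
noncomputable def stateProb (δ : Fin 2 → Fin 2 → ℝ) {n : ℕ} (s : Fin n → LinkState) : ℝ :=
  ∏ t, ∏ i, ∏ j, if s t i j then 1 - δ i j else δ i j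

/-- The first `t` link states `S^{t-1} = (S[1], …, S[t-1])` (time counted from `0` in `Fin n`):
the part of the state sequence that is strictly before the time instant `t`. -/
def past {n : ℕ} (s : Fin n → LinkState) (t : Fin n) : Fin t → LinkState :=
  fun u => s (Fin.castLE t.isLt.le u)

/-- A code of block length `n` where user `i` has `M i` messages. At time `t` the encoder of
transmitter `i` sees its own message and the link states strictly before `t`; the decoder of
receiver `i` sees its received sequence and the whole state sequence. -/
structure Code (n : ℕ) (M : Fin 2 → ℕ) where
  /-- the encoders `f_i` -/
  enc : (i : Fin 2) → Fin (M i) → (t : Fin n) → (Fin t → LinkState) → Bool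
  /-- the decoders `g_i` -/
  dec : (i : Fin 2) → (Fin n → Bool) → (Fin n → LinkState) → Fin (M i)

namespace Code

variable {n : ℕ} {M : Fin 2 → ℕ}

/-- The signal `X_i[t]` sent by transmitter `i` at time `t`. -/
def signal (C : Code n M) (w : (i : Fin 2) → Fin (M i)) (s : Fin n → LinkState)
    (i : Fin 2) (t : Fin n) : Bool :=
  C.enc i (w i) t (past s t)

/-- The signal `Y_i[t] = S_{ii}[t] X_i[t] ⊕ S_{īi}[t] X_ī[t]` received at receiver `i`. -/
def received (C : Code n M) (w : (i : Fin 2) → Fin (M i)) (s : Fin n → LinkState)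
    (i : Fin 2) (t : Fin n) : Bool :=
  xor (s t i i && C.signal w s i t) (s t (other i) i && C.signal w s (other i) t)

/-- The message `Ŵ_i` decoded by receiver `i`. -/
def decoded (C : Code n M) (w : (i : Fin 2) → Fin (M i)) (s : Fin n → LinkState)
    (i : Fin 2) : Fin (M i) :=
  C.dec i (C.received w s i) s

/-- The average probability of error `Pr[Ŵ_i ≠ W_i]` of user `i`, where the messages of the two
users are uniform and independent of each other and of the link states. -/
noncomputable def errorProb (C : Code n M) (δ : Fin 2 → Fin 2 → ℝ) (i : Fin 2) : ℝ :=
  (∏ k, (M k : ℝ))⁻¹ * ∑ w : (k : Fin 2) → Fin (M k), ∑ s : Fin n → LinkState,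
    stateProb δ s * (if C.decoded w s i ≠ w i then 1 else 0)

end Code

/-- The number of messages of a user with rate `r` in block length `n`: the number of integers
`1, 2, …` that are at most `2 ^ (n r)`. -/
noncomputable def numMessages (n : ℕ) (r : ℝ) : ℕ := ⌊(2 : ℝ) ^ ((n : ℝ) * r)⌋₊

/-- A pair of (non-negative) rates is achievable if there are codes, one for every block length,
for which both users' average probabilities of error tend to `0`. -/
def Achievable (δ : Fin 2 → Fin 2 → ℝ) (r : Fin 2 → ℝ) : Prop :=
  (∀ i, 0 ≤ r i) ∧
    ∃ C : (n : ℕ) → Code n (fun i => numMessages n (r i)),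
      ∀ i, Tendsto (fun n => (C n).errorProb δ i) atTop (𝓝 0)

/-- The capacity region: the closure of the set of achievable pairs of rates. -/
def capacityRegion (δ : Fin 2 → Fin 2 → ℝ) : Set (Fin 2 → ℝ) :=
  closure {r | Achievable δ r}

/-- The outer bound region. The second constraint has the denominator `1 - δ i ī`, so it is
imposed for those `i` with `δ i ī < 1`; multiplied by `1 - δ i ī`, it would for `δ i ī = 1` be
`(1 - δ i i) r ī ≤ (1 - δ i i) (1 - δ ī ī)`, which the first constraint implies. -/
def outerRegion (δ : Fin 2 → Fin 2 → ℝ) : Set (Fin 2 → ℝ) :=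
  {r | (∀ i, 0 ≤ r i ∧ r i ≤ 1 - δ i i) ∧
    ∀ i, δ i (other i) < 1 →
      r i + (1 - δ i i * δ i (other i)) / (1 - δ i (other i)) * r (other i) ≤
        (1 - δ i i * δ i (other i)) * (1 - δ (other i) (other i) * δ i (other i)) /
          (1 - δ i (other i))}

end IntermittentIC

/-! Freeze the state sequence `s`. The only randomness left is then a uniform message pair, so every
entropy is a finite count over fibres (`equivocation`); averaging over `s` comes afterwards. Fix
user i, give `W_ī` as side information, and let I(A) be the averaged information that the signals of
i carry through a link set A. Given `W_ī` the interference at receiver i is known, so Fano yields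
log M_i ≲ I({(i,i),(i,ī)}). Receiver ī, having decoded `W_ī`, cancels its own signal and sees `X_i`
wherever (i,ī) is on. Its output has at most n(1 - δ_īī δ_iī) bits on average, which leaves
I({(i,ī)}) ≲ n(1 - δ_īī δ_iī) log 2 - log M_ī. The two informations are linked by causality
(`erasure_comparison`). Since `X_i[t]` cannot depend on `S[t]`, the chain rule charges the
innovation of `X_i[t]` with the probability that A is on at t, and a larger A means a finer past,
hence a smaller innovation. So (1 - δ_iī) I({(i,i),(i,ī)}) ≤ (1 - δ_ii δ_iī) I({(i,ī)}). Combining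
the three, dividing by n log 2 and letting n → ∞ gives the weighted bound; the outer region is
closed, so the closure is covered too. -/

namespace IntermittentIC

/-! ### Entropy inequalities for uniform finite spaces -/

section Equivocation

open Finset

variable {Ω α β γ : Type*} [Fintype Ω]

open Classical in
/-- The number of points of `Ω` that `f` does not distinguish from `w`. -/
noncomputable def fiberCard (f : Ω → α) (w : Ω) : ℝ := #{v | f v = f w}

/-- `|Ω|` times the conditional entropy, in nats, of a uniform random point of `Ω` given its
image under `f`. -/
noncomputable def equivocation (f : Ω → α) : ℝ := ∑ w, Real.log (fiberCard f w)

theorem one_le_fiberCard (f : Ω → α) (w : Ω) : 1 ≤ fiberCard f w := by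
  classical
  unfold fiberCard
  exact_mod_cast Finset.card_pos.mpr ⟨w, by simp⟩

theorem fiberCard_pos (f : Ω → α) (w : Ω) : 0 < fiberCard f w :=
  zero_lt_one.trans_le (one_le_fiberCard f w)

theorem fiberCard_eq_of_eq {f : Ω → α} {u v : Ω} (h : f u = f v) :
    fiberCard f u = fiberCard f v := by
  unfold fiberCard
  rw [h]

theorem fiberCard_anti {f : Ω → α} {g : Ω → β} (h : ∀ u v, f u = f v → g u = g v) (w : Ω) :
    fiberCard f w ≤ fiberCard g w := by
  classical
  unfold fiberCard
  exact_mod_cast card_le_card fun v hv => by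
    simp only [mem_filter, mem_univ, true_and] at hv ⊢
    exact h v w hv

theorem equivocation_anti {f : Ω → α} {g : Ω → β} (h : ∀ u v, f u = f v → g u = g v) :
    equivocation f ≤ equivocation g :=
  sum_le_sum fun w _ => Real.log_le_log (fiberCard_pos f w) (fiberCard_anti h w)

theorem equivocation_congr {f : Ω → α} {g : Ω → β} (h : ∀ u v, f u = f v ↔ g u = g v) :
    equivocation f = equivocation g :=
  (equivocation_anti fun u v => (h u v).1).antisymm (equivocation_anti fun u v => (h u v).2)

theorem equivocation_of_injective {f : Ω → α} (hf : Function.Injective f) :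
    equivocation f = 0 := by
  classical
  refine sum_eq_zero fun w _ => ?_
  have : fiberCard f w = 1 := by
    rw [fiberCard, Nat.cast_eq_one, card_eq_one]
    exact ⟨w, by ext v; simp [hf.eq_iff]⟩
  simp [this]

theorem sum_const_fiber [DecidableEq α] (f : Ω → α) (w : Ω) (c : ℝ) :
    ∑ v with f v = f w, c = fiberCard f w * c := by
  rw [sum_const, nsmul_eq_mul, fiberCard]
  congr!

/-- Points weighted by the inverse size of their fibre give each fibre total weight at most 1, so
the sum is bounded by the number of fibres that `T` meets. -/
theorem sum_inv_fiberCard_le [DecidableEq α] (f : Ω → α) (T : Finset Ω) :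
    ∑ w ∈ T, (fiberCard f w)⁻¹ ≤ #(T.image f) := by
  rw [← sum_fiberwise_of_maps_to (g := f) (t := T.image f) fun x hx => mem_image_of_mem f hx,
    ← nsmul_one]
  refine sum_le_card_nsmul _ _ _ fun y hy => ?_
  obtain ⟨w, -, rfl⟩ := mem_image.1 hy
  calc ∑ v ∈ T with f v = f w, (fiberCard f v)⁻¹
      = ∑ v ∈ T with f v = f w, (fiberCard f w)⁻¹ :=
        sum_congr rfl fun v hv => by rw [fiberCard_eq_of_eq (mem_filter.1 hv).2]
    _ = #{v ∈ T | f v = f w} * (fiberCard f w)⁻¹ := by rw [sum_const, nsmul_eq_mul]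
    _ ≤ fiberCard f w * (fiberCard f w)⁻¹ := by
        refine mul_le_mul_of_nonneg_right ?_ (inv_nonneg.2 (fiberCard_pos f w).le)
        rw [← mul_one (fiberCard f w), ← sum_const_fiber, card_eq_sum_ones, Nat.cast_sum,
          Nat.cast_one]
        exact sum_le_sum_of_subset_of_nonneg (filter_subset_filter _ (subset_univ T))
          fun _ _ _ => zero_le_one
    _ = 1 := mul_inv_cancel₀ (fiberCard_pos f w).ne'

theorem sum_inv_fiberCard_le_one {f : Ω → α} {T : Finset Ω}
    (h : ∀ u ∈ T, ∀ v ∈ T, f u = f v) : ∑ w ∈ T, (fiberCard f w)⁻¹ ≤ 1 := by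
  classical
  refine (sum_inv_fiberCard_le f T).trans ?_
  have : #(T.image f) ≤ 1 := card_le_one.2 fun a ha b hb => by
    obtain ⟨u, hu, rfl⟩ := mem_image.1 ha
    obtain ⟨v, hv, rfl⟩ := mem_image.1 hb
    exact h u hu v hv
  exact_mod_cast this

theorem sum_fiberCard_mul [DecidableEq α] (f : Ω → α) (h : Ω → ℝ) :
    ∑ w, fiberCard f w * h w = ∑ v, ∑ w with f w = f v, h w := by
  simp_rw [sum_filter]
  rw [sum_comm]
  refine sum_congr rfl fun w _ => ?_
  rw [← sum_filter, ← sum_const_fiber]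
  simp_rw [eq_comm]

/-- Gibbs' inequality, from log z ≤ z - 1 at z = x/c. The three entropy inequalities below all
reduce to it through a counting bound; any excess of `B` over `|Ω|` is the loss. -/
theorem sum_log_le_of_sum_div_le {x c : Ω → ℝ} (hx : ∀ w, 0 < x w) (hc : ∀ w, 0 < c w) {B : ℝ}
    (h : ∑ w, x w * (c w)⁻¹ ≤ B) :
    ∑ w, Real.log (x w) ≤ ∑ w, Real.log (c w) + (B - Fintype.card Ω) := by
  have key : ∀ w, Real.log (x w) ≤ Real.log (c w) + (x w * (c w)⁻¹ - 1) := fun w => by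
    have := Real.log_le_sub_one_of_pos (mul_pos (hx w) (inv_pos.2 (hc w)))
    rw [Real.log_mul (hx w).ne' (inv_pos.2 (hc w)).ne', Real.log_inv] at this
    linarith
  calc _ ≤ ∑ w, (Real.log (c w) + (x w * (c w)⁻¹ - 1)) := sum_le_sum fun w _ => key w
    _ = ∑ w, Real.log (c w) + (∑ w, x w * (c w)⁻¹ - Fintype.card Ω) := by
      simp [sum_add_distrib, sum_sub_distrib]
    _ ≤ _ := by linarith

theorem equivocation_sub_eq (f : Ω → α) (g : Ω → β) :
    equivocation f - equivocation g = ∑ w, Real.log (fiberCard f w * (fiberCard g w)⁻¹) := by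
  rw [equivocation, equivocation, ← sum_sub_distrib]
  refine sum_congr rfl fun w _ => ?_
  rw [Real.log_mul (fiberCard_pos f w).ne' (inv_pos.2 (fiberCard_pos g w)).ne', Real.log_inv]
  ring

/-- Conditioning on more reduces the conditional entropy. -/
theorem equivocation_sub_le_of_determines {f : Ω → α} {g : Ω → β} (x : Ω → γ)
    (h : ∀ u v, f u = f v → g u = g v) :
    equivocation f - equivocation (fun w => (f w, x w)) ≤
      equivocation g - equivocation (fun w => (g w, x w)) := by
  classical
  set fx := fun w => (f w, x w)
  set gx := fun w => (g w, x w)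
  -- Double counting: for fixed u and v, the admissible w share both f and x, so they lie in one
  -- fibre of `fx` and have weight at most 1. As f determines g, there are none unless g v = g u.
  have inner (u : Ω) : ∑ w with f w = f u, fiberCard gx w * (fiberCard fx w)⁻¹ ≤
      fiberCard g u := by
    calc ∑ w with f w = f u, fiberCard gx w * (fiberCard fx w)⁻¹
        = ∑ w with f w = f u, ∑ v with gx v = gx w, (fiberCard fx w)⁻¹ := by
          simp_rw [sum_const_fiber]
      _ = ∑ v, ∑ w with (f w = f u ∧ gx v = gx w), (fiberCard fx w)⁻¹ := by
          exact sum_comm' fun w v => by simp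
      _ ≤ ∑ v, if g v = g u then (1 : ℝ) else 0 := by
          refine sum_le_sum fun v _ => ?_
          split_ifs with hv
          · refine sum_inv_fiberCard_le_one fun a ha b hb => ?_
            simp only [mem_filter, mem_univ, true_and, gx, Prod.mk.injEq] at ha hb
            simp only [fx, Prod.mk.injEq]
            exact ⟨ha.1.trans hb.1.symm, ha.2.2.symm.trans hb.2.2⟩
          · refine (sum_eq_zero fun w hw => ?_).le
            simp only [mem_filter, mem_univ, true_and, gx, Prod.mk.injEq] at hw
            exact absurd (hw.2.1.trans (h _ _ hw.1)) hv
      _ = fiberCard g u := by rw [← sum_filter, sum_const_fiber g u, mul_one]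
  have total : ∑ w, fiberCard f w * (fiberCard fx w)⁻¹ *
      (fiberCard g w * (fiberCard gx w)⁻¹)⁻¹ ≤ Fintype.card Ω := by
    calc _ = ∑ w, fiberCard f w *
          (fiberCard gx w * (fiberCard fx w)⁻¹ * (fiberCard g w)⁻¹) := by
          refine sum_congr rfl fun w _ => ?_
          rw [mul_inv, inv_inv]
          ring
      _ = ∑ u, ∑ w with f w = f u,
          fiberCard gx w * (fiberCard fx w)⁻¹ * (fiberCard g w)⁻¹ := sum_fiberCard_mul _ _
      _ = ∑ u, (∑ w with f w = f u, fiberCard gx w * (fiberCard fx w)⁻¹) *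
          (fiberCard g u)⁻¹ := by
          refine sum_congr rfl fun u _ => ?_
          rw [sum_mul]
          refine sum_congr rfl fun w hw => ?_
          rw [fiberCard_eq_of_eq (h _ _ (mem_filter.1 hw).2)]
      _ ≤ ∑ u : Ω, 1 := by
          refine sum_le_sum fun u _ => ?_
          rw [← mul_inv_cancel₀ (fiberCard_pos g u).ne']
          exact mul_le_mul_of_nonneg_right (inner u) (inv_nonneg.2 (fiberCard_pos g u).le)
      _ = Fintype.card Ω := by simp
  rw [equivocation_sub_eq, equivocation_sub_eq]
  refine (sum_log_le_of_sum_div_le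
    (fun w => mul_pos (fiberCard_pos f w) (inv_pos.2 (fiberCard_pos fx w)))
    (fun w => mul_pos (fiberCard_pos g w) (inv_pos.2 (fiberCard_pos gx w))) total).trans ?_
  simp

/-- The conditional entropy of a random variable is at most the logarithm of the number of its
values. -/
theorem equivocation_sub_le_log_card (f : Ω → α) (y : Ω → β) {T : Finset β}
    (hy : ∀ w, y w ∈ T) :
    equivocation f - equivocation (fun w => (f w, y w)) ≤ Fintype.card Ω * Real.log #T := by
  classical
  rcases isEmpty_or_nonempty Ω with hΩ | ⟨⟨w₀⟩⟩
  · simp [equivocation]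
  set fy := fun w => (f w, y w)
  have hT : (0 : ℝ) < #T := by exact_mod_cast card_pos.2 ⟨_, hy w₀⟩
  have total : ∑ w, fiberCard f w * (fiberCard fy w)⁻¹ * (#T : ℝ)⁻¹ ≤ Fintype.card Ω := by
    calc _ = (∑ v, ∑ w with f w = f v, (fiberCard fy w)⁻¹) * (#T : ℝ)⁻¹ := by
          rw [← sum_fiberCard_mul f, sum_mul]
      _ ≤ (∑ v : Ω, (#T : ℝ)) * (#T : ℝ)⁻¹ := by
          refine mul_le_mul_of_nonneg_right (sum_le_sum fun v _ => ?_) (inv_nonneg.2 hT.le)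
          refine (sum_inv_fiberCard_le _ _).trans ?_
          have : image fy {w | f w = f v} ⊆ T.image (fun b => (f v, b)) := by
            intro p hp
            obtain ⟨w, hw, rfl⟩ := mem_image.1 hp
            exact mem_image.2 ⟨y w, hy w, by rw [← (mem_filter.1 hw).2]⟩
          exact_mod_cast (card_le_card this).trans card_image_le
      _ = Fintype.card Ω := by
          rw [sum_const, nsmul_eq_mul, mul_assoc, mul_inv_cancel₀ hT.ne', mul_one, card_univ]
  rw [equivocation_sub_eq]
  refine (sum_log_le_of_sum_div_le
    (fun w => mul_pos (fiberCard_pos f w) (inv_pos.2 (fiberCard_pos fy w)))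
    (fun _ => hT) total).trans ?_
  simp

/-- Fano's inequality. -/
theorem equivocation_sub_le_fano {M : ℕ} (y : Ω → α) (v : Ω → Fin M) (g : α → Fin M) :
    equivocation y - equivocation (fun w => (y w, v w)) ≤
      (∑ w, if g (y w) ≠ v w then (1 : ℝ) else 0) * Real.log M + Fintype.card Ω := by
  classical
  rcases isEmpty_or_nonempty Ω with hΩ | ⟨⟨w₀⟩⟩
  · simp [equivocation]
  set yv := fun w => (y w, v w)
  have hM : (0 : ℝ) < M := by exact_mod_cast (v w₀).pos
  -- `1 / c` is an unnormalized guess of v given y: weight 1 on the decoded message and 1/M on the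
  -- others. Its mass is at most 2, so the loss is at most one nat per point.
  set c : Ω → ℝ := fun w => if g (y w) ≠ v w then (M : ℝ) else 1
  have hc (w) : 0 < c w := by
    simp only [c]
    split_ifs <;> positivity
  have hc' (w) : (c w)⁻¹ ≤ (if g (y w) = v w then 1 else 0) + (M : ℝ)⁻¹ := by
    simp only [c]
    by_cases hw : g (y w) = v w <;> simp [hw]
  have total : ∑ w, fiberCard y w * (fiberCard yv w)⁻¹ * (c w)⁻¹ ≤ 2 * Fintype.card Ω := by
    calc _ = ∑ u, ∑ w with y w = y u, (fiberCard yv w)⁻¹ * (c w)⁻¹ := by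
          rw [← sum_fiberCard_mul y]
          exact sum_congr rfl fun w _ => by ring
      _ ≤ ∑ u : Ω, 2 := by
          refine sum_le_sum fun u _ => ?_
          calc _ ≤ ∑ w with y w = y u, ((if g (y w) = v w then (fiberCard yv w)⁻¹ else 0) +
                (fiberCard yv w)⁻¹ * (M : ℝ)⁻¹) := by
                refine sum_le_sum fun w _ => ?_
                refine (mul_le_mul_of_nonneg_left (hc' w)
                  (inv_nonneg.2 (fiberCard_pos yv w).le)).trans ?_
                rw [mul_add, mul_ite, mul_one, mul_zero]
            _ ≤ 1 + M * (M : ℝ)⁻¹ := by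
                rw [sum_add_distrib, ← sum_mul, ← sum_filter, filter_filter]
                gcongr
                · refine sum_inv_fiberCard_le_one fun a ha b hb => ?_
                  simp only [mem_filter, mem_univ, true_and] at ha hb
                  simp only [yv, Prod.mk.injEq]
                  rw [← ha.2, ← hb.2, ha.1, hb.1]
                  exact ⟨rfl, rfl⟩
                · refine (sum_inv_fiberCard_le _ _).trans ?_
                  have : image yv {w | y w = y u} ⊆ univ.image (fun b => (y u, b)) := by
                    intro p hp
                    obtain ⟨w, hw, rfl⟩ := mem_image.1 hp
                    exact mem_image.2 ⟨v w, mem_univ _, by rw [← (mem_filter.1 hw).2]⟩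
                  have := (card_le_card this).trans card_image_le
                  rw [card_univ, Fintype.card_fin] at this
                  exact_mod_cast this
            _ = 2 := by
                rw [mul_inv_cancel₀ hM.ne']
                norm_num
      _ = _ := by simp [mul_comm]
  rw [equivocation_sub_eq]
  refine (sum_log_le_of_sum_div_le
    (fun w => mul_pos (fiberCard_pos y w) (inv_pos.2 (fiberCard_pos yv w))) hc total).trans ?_
  have : ∑ w, Real.log (c w) = (∑ w, if g (y w) ≠ v w then (1 : ℝ) else 0) * Real.log M := by
    rw [sum_mul]
    refine sum_congr rfl fun w _ => ?_
    simp only [c]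
    split_ifs <;> simp
  rw [this]
  linarith

end Equivocation

/-! ### Delayed state information and the comparison of erasures -/

section Causality

open Finset

/-- Under a product distribution, a function of one coordinate is independent of a function of
the other coordinates. -/
theorem sum_prod_mul_eq {ι A : Type*} [Fintype ι] [DecidableEq ι] [Fintype A] {q : A → ℝ}
    (hq : ∑ a, q a = 1) (t : ι) (g : A → ℝ) {J : (ι → A) → ℝ}
    (hJ : ∀ s s' : ι → A, (∀ u, u ≠ t → s u = s' u) → J s = J s') :
    ∑ s : ι → A, (∏ u, q (s u)) * (g (s t) * J s) =
      (∑ a, q a * g a) * ∑ s : ι → A, (∏ u, q (s u)) * J s := by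
  rcases isEmpty_or_nonempty A with hA | ⟨⟨a₀⟩⟩
  · simp at hq
  let e := (Equiv.funSplitAt t A).symm
  have split (g : A → ℝ) : ∑ s : ι → A, (∏ u, q (s u)) * (g (s t) * J s) =
      (∑ a, q a * g a) * ∑ r, (∏ u, q (r u)) * J (e (a₀, r)) := by
    rw [← e.sum_comp, Fintype.sum_prod_type, sum_mul]
    refine sum_congr rfl fun a _ => ?_
    rw [mul_sum]
    refine sum_congr rfl fun r _ => ?_
    have h1 : e (a, r) t = a := by simp [e, Equiv.funSplitAt, Equiv.piSplitAt]
    have h2 (b : A) (u : ι) (hu : u ≠ t) : e (b, r) u = r ⟨u, hu⟩ := by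
      simp [e, Equiv.funSplitAt, Equiv.piSplitAt, hu]
    have h3 : J (e (a, r)) = J (e (a₀, r)) := hJ _ _ fun u hu => by rw [h2 _ u hu, h2 _ u hu]
    have h4 : ∏ u, q (e (a, r) u) = q a * ∏ u, q (r u) := by
      rw [Fintype.prod_eq_mul_prod_compl t, h1, 
        prod_subtype (p := fun u => u ≠ t) {t}ᶜ (by simp) (fun u => q (e (a, r) u))]
      exact congrArg _ (prod_congr rfl fun u _ => by rw [h2 a u u.2])
    rw [h1, h3, h4]
    ring
  -- Taking g = 1 identifies the remaining factor with the full expectation of J.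
  have h1 := split fun _ => 1
  simp only [one_mul, mul_one, hq] at h1
  rw [split, h1]

/-- Probability of the states of the four links at one time instant. -/
noncomputable def letterProb (δ : Fin 2 → Fin 2 → ℝ) (x : LinkState) : ℝ :=
  ∏ i, ∏ j, if x i j then 1 - δ i j else δ i j

theorem stateProb_eq_prod (δ : Fin 2 → Fin 2 → ℝ) {n : ℕ} (s : Fin n → LinkState) :
    stateProb δ s = ∏ t, letterProb δ (s t) := rfl

/-- At least one of the links in `A` is on. -/
def anyOn (A : Finset (Fin 2 × Fin 2)) (x : LinkState) : Bool :=
  decide (∃ e ∈ A, x e.1 e.2 = true)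

theorem sum_prod_links (h : Fin 2 → Fin 2 → Bool → ℝ) :
    ∑ x : LinkState, ∏ i, ∏ j, h i j (x i j) = ∏ i, ∏ j, (h i j true + h i j false) := by
  have (i : Fin 2) : ∏ j, (h i j true + h i j false) = ∑ y : Fin 2 → Bool, ∏ j, h i j (y j) := by
    rw [← Fintype.prod_sum]
    simp
  simp_rw [this]
  exact (Fintype.prod_sum fun i (y : Fin 2 → Bool) => ∏ j, h i j (y j)).symm

theorem sum_letterProb (δ : Fin 2 → Fin 2 → ℝ) : ∑ x, letterProb δ x = 1 := by
  have := sum_prod_links fun i j b => if b then 1 - δ i j else δ i j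
  simpa [letterProb] using this

theorem sum_letterProb_mul_allOff (δ : Fin 2 → Fin 2 → ℝ) (A : Finset (Fin 2 × Fin 2)) :
    ∑ x, letterProb δ x * (if anyOn A x then 0 else 1) = ∏ e ∈ A, δ e.1 e.2 := by
  have h1 := sum_prod_links fun i j b =>
    (if b then 1 - δ i j else δ i j) * if (i, j) ∈ A ∧ b = true then 0 else 1
  have h2 : ∏ e ∈ A, δ e.1 e.2 = ∏ i, ∏ j, if (i, j) ∈ A then δ i j else 1 := by
    rw [← Fintype.prod_prod_type' (fun i j => if (i, j) ∈ A then δ i j else 1),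
      Finset.prod_ite_mem_eq]
  rw [h2]
  convert h1 using 1
  · refine sum_congr rfl fun x _ => ?_
    simp_rw [prod_mul_distrib]
    congr 1
    rw [← Fintype.prod_prod_type' (fun i j => if (i, j) ∈ A ∧ x i j = true then (0 : ℝ) else 1)]
    by_cases hx : anyOn A x
    · obtain ⟨e, he, hxe⟩ := of_decide_eq_true hx
      rw [if_pos hx, prod_eq_zero (mem_univ e)]
      simp [he, hxe]
    · rw [if_neg hx, prod_eq_one]
      intro e _
      rw [if_neg]
      rintro ⟨he, hxe⟩
      exact hx (decide_eq_true ⟨e, he, hxe⟩)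
  · refine prod_congr rfl fun i _ => prod_congr rfl fun j _ => ?_
    by_cases hij : (i, j) ∈ A <;> simp [hij]

theorem sum_letterProb_mul_anyOn (δ : Fin 2 → Fin 2 → ℝ) (A : Finset (Fin 2 × Fin 2)) :
    ∑ x, letterProb δ x * (if anyOn A x then 1 else 0) = 1 - ∏ e ∈ A, δ e.1 e.2 := by
  rw [← sum_letterProb_mul_allOff, eq_sub_iff_add_eq, ← sum_add_distrib]
  refine Eq.trans ?_ (sum_letterProb δ)
  refine sum_congr rfl fun x _ => ?_
  split_ifs <;> simp

theorem sum_stateProb (δ : Fin 2 → Fin 2 → ℝ) (n : ℕ) :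
    ∑ s : Fin n → LinkState, stateProb δ s = 1 := by
  simp_rw [stateProb_eq_prod]
  rw [← Fintype.prod_sum]
  simp [sum_letterProb]

theorem stateProb_nonneg {δ : Fin 2 → Fin 2 → ℝ} (hδ : ∀ i j, 0 ≤ δ i j ∧ δ i j ≤ 1) {n : ℕ}
    (s : Fin n → LinkState) : 0 ≤ stateProb δ s :=
  prod_nonneg fun _ _ => prod_nonneg fun i _ => prod_nonneg fun j _ => by
    split_ifs
    · linarith [(hδ i j).2]
    · exact (hδ i j).1

theorem sum_stateProb_mul_anyOn_mul (δ : Fin 2 → Fin 2 → ℝ) (A : Finset (Fin 2 × Fin 2)) {n : ℕ}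
    (t : Fin n) {J : (Fin n → LinkState) → ℝ}
    (hJ : ∀ s s' : Fin n → LinkState, (∀ u, u ≠ t → s u = s' u) → J s = J s') :
    ∑ s, stateProb δ s * (if anyOn A (s t) then J s else 0) =
      (1 - ∏ e ∈ A, δ e.1 e.2) * ∑ s, stateProb δ s * J s := by
  rw [← sum_letterProb_mul_anyOn]
  simp_rw [stateProb_eq_prod]
  rw [← sum_prod_mul_eq (sum_letterProb δ) t (fun x => if anyOn A x then 1 else 0) hJ]
  simp

variable {Ω β : Type*} {n : ℕ}

/-- The side information `V` and the first `t` signals, each erased unless a link of `A` is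
on. -/
def erasedPrefix (A : Finset (Fin 2 × Fin 2)) (V : Ω → β)
    (X : (Fin n → LinkState) → Fin n → Ω → Bool) (s : Fin n → LinkState) (t : ℕ) (w : Ω) :
    β × (Fin n → Bool) :=
  (V w, fun u => decide (u.val < t) && (anyOn A (s u) && X s u w))

theorem erasedPrefix_eq_iff (A : Finset (Fin 2 × Fin 2)) (V : Ω → β)
    (X : (Fin n → LinkState) → Fin n → Ω → Bool) (s : Fin n → LinkState) (t : ℕ) (w v : Ω) :
    erasedPrefix A V X s t w = erasedPrefix A V X s t v ↔ V w = V v ∧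
      ∀ u : Fin n, u.val < t → anyOn A (s u) = true → X s u w = X s u v := by
  simp only [erasedPrefix, Prod.mk.injEq, funext_iff]
  refine and_congr_right fun _ => forall_congr' fun u => ?_
  by_cases h1 : u.val < t <;> by_cases h2 : anyOn A (s u) = true <;> simp [h1, h2]

variable [Fintype Ω]

/-- `|Ω|` times the conditional entropy of the signal at time `t`, given the erased earlier
signals. -/
noncomputable def innovation (A : Finset (Fin 2 × Fin 2)) (V : Ω → β)
    (X : (Fin n → LinkState) → Fin n → Ω → Bool) (t : Fin n) (s : Fin n → LinkState) : ℝ :=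
  equivocation (erasedPrefix A V X s t) -
    equivocation (fun w => (erasedPrefix A V X s t w, X s t w))

/-- One step of the chain rule: the prefix gains the signal at time t when a link of `A` is on, and
nothing otherwise. -/
theorem equivocation_sub_succ (A : Finset (Fin 2 × Fin 2)) (V : Ω → β)
    (X : (Fin n → LinkState) → Fin n → Ω → Bool) (t : Fin n) (s : Fin n → LinkState) :
    equivocation (erasedPrefix A V X s t) - equivocation (erasedPrefix A V X s (t + 1)) =
      if anyOn A (s t) then innovation A V X t s else 0 := by
  have lt_succ (u : Fin n) : u.val < t.val + 1 ↔ u.val < t.val ∨ u = t := by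
    rw [Nat.lt_succ_iff_lt_or_eq, Fin.ext_iff]
  split_ifs with h
  · rw [innovation]
    congr 1
    refine equivocation_congr fun w v => ?_
    rw [erasedPrefix_eq_iff, Prod.mk_inj, erasedPrefix_eq_iff, and_assoc]
    simp_rw [lt_succ]
    refine and_congr_right fun _ => ⟨fun H => ⟨fun u hu => H u (.inl hu), H t (.inr rfl) h⟩, ?_⟩
    rintro ⟨H1, H2⟩ u (hu | rfl) h'
    exacts [H1 u hu h', H2]
  · rw [sub_eq_zero]
    refine equivocation_congr fun w v => ?_
    rw [erasedPrefix_eq_iff, erasedPrefix_eq_iff]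
    simp_rw [lt_succ]
    refine and_congr_right fun _ => ⟨?_, fun H u hu => H u (.inl hu)⟩
    rintro H u (hu | rfl) h'
    exacts [H u hu h', absurd h' h]

theorem equivocation_sub_erasedPrefix (A : Finset (Fin 2 × Fin 2)) (V : Ω → β)
    (X : (Fin n → LinkState) → Fin n → Ω → Bool) (s : Fin n → LinkState) :
    equivocation V - equivocation (erasedPrefix A V X s n) =
      ∑ t : Fin n, if anyOn A (s t) then innovation A V X t s else 0 := by
  simp_rw [← equivocation_sub_succ]
  rw [Fin.sum_univ_eq_sum_range (fun t => equivocation (erasedPrefix A V X s t) -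
    equivocation (erasedPrefix A V X s (t + 1))) n, sum_range_sub']
  congr 1
  exact equivocation_congr fun w v => by simp [erasedPrefix_eq_iff]

/-- This is where the unit delay enters: the prefix and the signal at time t involve only earlier
states, so the innovation is independent of `S[t]`. -/
theorem innovation_congr (A : Finset (Fin 2 × Fin 2)) (V : Ω → β)
    {X : (Fin n → LinkState) → Fin n → Ω → Bool}
    (hX : ∀ s s' t, (∀ u < t, s u = s' u) → X s t = X s' t) (t : Fin n)
    (s s' : Fin n → LinkState) (h : ∀ u, u ≠ t → s u = s' u) :
    innovation A V X t s = innovation A V X t s' := by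
  have h1 : erasedPrefix A V X s t = erasedPrefix A V X s' t := by
    ext w u
    · rfl
    · by_cases hu : u < t
      · simp [erasedPrefix, h u hu.ne, hX s s' u fun x hx => h x (hx.trans hu).ne]
      · have : ¬ u.val < t.val := hu
        simp [erasedPrefix, hu]
  rw [innovation, innovation, h1, hX s s' t fun u hu => h u hu.ne]

theorem sum_stateProb_mul_equivocation_sub (δ : Fin 2 → Fin 2 → ℝ) (A : Finset (Fin 2 × Fin 2))
    (V : Ω → β) {X : (Fin n → LinkState) → Fin n → Ω → Bool}
    (hX : ∀ s s' t, (∀ u < t, s u = s' u) → X s t = X s' t) :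
    ∑ s, stateProb δ s * (equivocation V - equivocation (erasedPrefix A V X s n)) =
      (1 - ∏ e ∈ A, δ e.1 e.2) * ∑ t, ∑ s, stateProb δ s * innovation A V X t s := by
  simp_rw [equivocation_sub_erasedPrefix, mul_sum]
  rw [sum_comm]
  refine sum_congr rfl fun t _ => ?_
  rw [sum_stateProb_mul_anyOn_mul δ A t (innovation_congr A V hX t), mul_sum]

/-- With delayed channel state information, what is learned about the signals through the links
of `A'`, relative to the probability that one of these links is on, is at most what is
learned through a part `A` of these links. -/
theorem erasure_comparison {δ : Fin 2 → Fin 2 → ℝ} (hδ : ∀ i j, 0 ≤ δ i j ∧ δ i j ≤ 1)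
    {A A' : Finset (Fin 2 × Fin 2)} (hA : A ⊆ A')
    (V : Ω → β) {X : (Fin n → LinkState) → Fin n → Ω → Bool}
    (hX : ∀ s s' t, (∀ u < t, s u = s' u) → X s t = X s' t) :
    (1 - ∏ e ∈ A, δ e.1 e.2) *
        ∑ s, stateProb δ s * (equivocation V - equivocation (erasedPrefix A' V X s n)) ≤
      (1 - ∏ e ∈ A', δ e.1 e.2) *
        ∑ s, stateProb δ s * (equivocation V - equivocation (erasedPrefix A V X s n)) := by
  rw [sum_stateProb_mul_equivocation_sub δ A V hX, sum_stateProb_mul_equivocation_sub δ A' V hX,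
    mul_left_comm]
  have on_nonneg (B : Finset (Fin 2 × Fin 2)) : 0 ≤ 1 - ∏ e ∈ B, δ e.1 e.2 :=
    sub_nonneg.2 (prod_le_one (fun e _ => (hδ e.1 e.2).1) fun e _ => (hδ e.1 e.2).2)
  refine mul_le_mul_of_nonneg_left (mul_le_mul_of_nonneg_left (sum_le_sum fun t _ =>
    sum_le_sum fun s _ => mul_le_mul_of_nonneg_left ?_ (stateProb_nonneg hδ s)) (on_nonneg A))
    (on_nonneg A')
  -- Both sides now carry the same constants, and the prefix through `A'` determines the one through
  -- `A`, so its innovation is the smaller one.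
  refine equivocation_sub_le_of_determines _ fun w v h => ?_
  rw [erasedPrefix_eq_iff] at h ⊢
  refine ⟨h.1, fun u hu hs => h.2 u hu ?_⟩
  obtain ⟨e, he, hs⟩ := of_decide_eq_true hs
  exact decide_eq_true ⟨e, hA he, hs⟩

end Causality

/-! ### Bounds at a fixed block length -/

section FiniteLength

open Finset

/-- Number of time instants at which at least one link in `B` is on. -/
def onCount (B : Finset (Fin 2 × Fin 2)) {n : ℕ} (s : Fin n → LinkState) : ℝ :=
  ∑ t, if anyOn B (s t) then 1 else 0

theorem sum_stateProb_mul_onCount (δ : Fin 2 → Fin 2 → ℝ) (B : Finset (Fin 2 × Fin 2)) (n : ℕ) :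
    ∑ s : Fin n → LinkState, stateProb δ s * onCount B s = n * (1 - ∏ e ∈ B, δ e.1 e.2) := by
  simp_rw [onCount, mul_sum]
  rw [sum_comm]
  simp_rw [sum_stateProb_mul_anyOn_mul δ B _ (J := fun _ => 1) fun _ _ _ => rfl, mul_one,
    sum_stateProb]
  simp only [mul_one, sum_const, card_univ, Fintype.card_fin, nsmul_eq_mul]

/-- A sequence that vanishes whenever all links of `B` are off has one free bit per remaining
instant. -/
theorem equivocation_sub_le_onCount {Ω α : Type*} [Fintype Ω] {n : ℕ} (f : Ω → α)
    {y : Ω → Fin n → Bool} {B : Finset (Fin 2 × Fin 2)} {s : Fin n → LinkState}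
    (hy : ∀ w t, ¬ anyOn B (s t) = true → y w t = false) :
    equivocation f - equivocation (fun w => (f w, y w)) ≤
      Fintype.card Ω * (onCount B s * Real.log 2) := by
  refine (equivocation_sub_le_log_card f y
    (T := Fintype.piFinset fun t => if anyOn B (s t) then univ else {false}) ?_).trans_eq ?_
  · intro w
    rw [Fintype.mem_piFinset]
    intro t
    by_cases h : anyOn B (s t) = true
    · simp [h]
    · simp [h, hy w t h]
  · rw [Fintype.card_piFinset, Nat.cast_prod, Real.log_prod, onCount, sum_mul]
    · congr 1
      refine sum_congr rfl fun t _ => ?_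
      split_ifs <;> simp
    · intro t _
      split_ifs <;> simp

theorem eq_or_eq_other (i k : Fin 2) : k = i ∨ k = other i := by
  revert i k
  decide

theorem other_ne (i : Fin 2) : other i ≠ i := by
  revert i
  decide

theorem other_other (i : Fin 2) : other (other i) = i := by
  revert i
  decide

theorem prod_eq_mul_other (i : Fin 2) (f : Fin 2 → ℝ) : ∏ k, f k = f i * f (other i) := by
  fin_cases i <;> simp [other, Fin.prod_univ_two, mul_comm]

variable {n : ℕ} {M : Fin 2 → ℕ}

theorem equivocation_other_message (i : Fin 2) :
    equivocation (fun w : (k : Fin 2) → Fin (M k) => w (other i)) =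
      Fintype.card ((k : Fin 2) → Fin (M k)) * Real.log (M i) := by
  classical
  have (w : (k : Fin 2) → Fin (M k)) :
      fiberCard (fun w : (k : Fin 2) → Fin (M k) => w (other i)) w = M i := by
    have h := Fintype.card_filter_piFinset_eq_of_mem (fun k => (univ : Finset (Fin (M k))))
      (other i) (mem_univ (w (other i)))
    have h' : (univ : Finset (Fin 2)).erase (other i) = {i} := by
      clear h
      revert i
      decide
    rw [h', prod_singleton, Fintype.piFinset_univ, card_univ, Fintype.card_fin] at h
    rw [fiberCard, ← h]
    congr!
  simp_rw [equivocation, this]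
  simp

theorem equivocation_const {Ω : Type*} [Fintype Ω] :
    equivocation (fun _ : Ω => ()) = Fintype.card Ω * Real.log (Fintype.card Ω) := by
  simp [equivocation, fiberCard]

namespace Code

variable (C : Code n M)

/-- Number of message pairs that are decoded wrongly at receiver `k`. -/
def errorCount (s : Fin n → LinkState) (k : Fin 2) : ℝ :=
  ∑ w : (k : Fin 2) → Fin (M k), if C.decoded w s k ≠ w k then 1 else 0

theorem errorProb_nonneg {δ : Fin 2 → Fin 2 → ℝ} (hδ : ∀ i j, 0 ≤ δ i j ∧ δ i j ≤ 1) (k : Fin 2) :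
    0 ≤ C.errorProb δ k := by
  refine mul_nonneg (inv_nonneg.2 (prod_nonneg fun _ _ => Nat.cast_nonneg _))
    (sum_nonneg fun w _ => sum_nonneg fun s _ => mul_nonneg (stateProb_nonneg hδ s) ?_)
  split_ifs <;> norm_num

theorem sum_stateProb_mul_errorCount (hM : ∀ k, 0 < M k) (δ : Fin 2 → Fin 2 → ℝ) (k : Fin 2) :
    ∑ s, stateProb δ s * C.errorCount s k =
      Fintype.card ((k : Fin 2) → Fin (M k)) * C.errorProb δ k := by
  have hm : (∏ k, (M k : ℝ)) ≠ 0 := prod_ne_zero_iff.2 fun k _ => by exact_mod_cast (hM k).ne'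
  have hc : (Fintype.card ((k : Fin 2) → Fin (M k)) : ℝ) = ∏ k, (M k : ℝ) := by simp
  rw [errorProb, hc, mul_inv_cancel_left₀ hm, sum_comm]
  simp_rw [errorCount, mul_sum]

theorem signal_congr (w : (k : Fin 2) → Fin (M k)) (i : Fin 2) (s s' : Fin n → LinkState)
    (t : Fin n) (h : ∀ u < t, s u = s' u) : C.signal w s i t = C.signal w s' i t := by
  have : past s t = past s' t := funext fun u => h _ u.isLt
  rw [signal, signal, this]

theorem signal_eq_of_message_eq {w v : (k : Fin 2) → Fin (M k)} {i : Fin 2} (h : w i = v i)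
    (s : Fin n → LinkState) (t : Fin n) : C.signal w s i t = C.signal v s i t := by
  rw [signal, signal, h]

/-- The signals of user `i`, as functions of the message pair. -/
def signalOf (i : Fin 2) (s : Fin n → LinkState) (t : Fin n) (w : (k : Fin 2) → Fin (M k)) :
    Bool :=
  C.signal w s i t

/-- The entropy of the message of user `i` is carried by its signals over the links in `A`, up to
the loss from decoding errors. -/
theorem log_card_le_equivocation_sub (i : Fin 2)
    {A : Finset (Fin 2 × Fin 2)} (hA : (i, i) ∈ A) (s : Fin n → LinkState) :
    Fintype.card ((k : Fin 2) → Fin (M k)) * (Real.log (M i) - 1) -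
        C.errorCount s i * Real.log (M i) ≤
      equivocation (fun w : (k : Fin 2) → Fin (M k) => w (other i)) -
        equivocation (erasedPrefix A (fun w => w (other i)) (C.signalOf i) s n) := by
  set y := fun w : (k : Fin 2) → Fin (M k) => (C.received w s i, w (other i))
  have h1 := equivocation_sub_le_fano y (fun w => w i) fun p => C.dec i p.1 s
  have h2 : equivocation (fun w => (y w, w i)) = 0 := by
    refine equivocation_of_injective fun w v h => ?_
    simp only [y, Prod.mk.injEq] at h
    funext k
    rcases eq_or_eq_other i k with rfl | rfl
    exacts [h.2, h.1.2]
  -- Knowing `W_ī` fixes the interference, so the output at receiver i depends only on `X_i` at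
  -- times when (i,i) is on.
  have h3 : equivocation (erasedPrefix A (fun w => w (other i)) (C.signalOf i) s n) ≤
      equivocation y := by
    refine equivocation_anti fun w v h => ?_
    rw [erasedPrefix_eq_iff] at h
    refine Prod.ext (funext fun t => ?_) h.1
    simp only [y, received]
    rw [C.signal_eq_of_message_eq h.1 s t]
    congr 1
    by_cases ht : s t i i = true
    · have : C.signal w s i t = C.signal v s i t :=
        h.2 t t.isLt (decide_eq_true ⟨(i, i), hA, ht⟩)
      rw [this]
    · simp [ht]
  have h4 : (∑ w, if C.dec i (y w).1 s ≠ w i then (1 : ℝ) else 0) = C.errorCount s i := rfl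
  rw [h2, h4] at h1
  rw [equivocation_other_message]
  linarith

/-- The interference at the receiver of the other user limits the rate of that user. -/
theorem equivocation_sub_le_of_decoding (hM : ∀ k, 0 < M k) (i : Fin 2) (s : Fin n → LinkState) :
    equivocation (fun w : (k : Fin 2) → Fin (M k) => w (other i)) -
        equivocation (erasedPrefix {(i, other i)} (fun w => w (other i)) (C.signalOf i) s n) ≤
      Fintype.card ((k : Fin 2) → Fin (M k)) *
          (onCount {(other i, other i), (i, other i)} s * Real.log 2 -
            (Real.log (M (other i)) - 1)) +
        C.errorCount s (other i) * Real.log (M (other i)) := by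
  set y := fun w : (k : Fin 2) → Fin (M k) => C.received w s (other i) with hy
  have h1 := equivocation_sub_le_fano y (fun w => w (other i)) fun p => C.dec (other i) p s
  -- With `W_ī` known, its signal is cancelled from the output at ī, which exposes `X_i` whenever
  -- (i,ī) is on.
  have h2 : equivocation (fun w => (y w, w (other i))) ≤
      equivocation (erasedPrefix {(i, other i)} (fun w => w (other i)) (C.signalOf i) s n) := by
    refine equivocation_anti fun w v h => ?_
    rw [Prod.mk_inj] at h
    rw [erasedPrefix_eq_iff]
    refine ⟨h.2, fun t _ ht => ?_⟩
    have hs : s t i (other i) = true := by simpa [anyOn] using ht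
    have h3 := congrFun h.1 t
    simp only [y, received, other_other, hs, Bool.true_and] at h3
    rw [C.signal_eq_of_message_eq h.2 s t] at h3
    exact Bool.xor_right_inj.1 h3
  have h3 := equivocation_sub_le_onCount (fun _ : (k : Fin 2) → Fin (M k) => ()) (y := y)
    (B := {(other i, other i), (i, other i)}) (s := s) fun w t ht => by
      simp [anyOn] at ht
      simp [y, received, other_other, ht]
  have h4 : equivocation (fun w => ((), y w)) = equivocation y :=
    equivocation_congr fun w v => by simp
  have h5 : (∑ w, if C.dec (other i) (y w) s ≠ w (other i) then (1 : ℝ) else 0) =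
    C.errorCount s (other i) := rfl
  have h6 : Real.log (Fintype.card ((k : Fin 2) → Fin (M k))) =
      Real.log (M i) + Real.log (M (other i)) := by
    rw [← Real.log_mul (by exact_mod_cast (hM _).ne') (by exact_mod_cast (hM _).ne'),
      ← prod_eq_mul_other i fun k => (M k : ℝ)]
    simp
  rw [h5] at h1
  rw [equivocation_const, h4, h6] at h3
  rw [equivocation_other_message]
  linarith

theorem sum_stateProb_mul_log_card_le {δ : Fin 2 → Fin 2 → ℝ}
    (hδ : ∀ i j, 0 ≤ δ i j ∧ δ i j ≤ 1) (hM : ∀ k, 0 < M k) (i : Fin 2)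
    {A : Finset (Fin 2 × Fin 2)} (hA : (i, i) ∈ A) :
    Fintype.card ((k : Fin 2) → Fin (M k)) *
        (Real.log (M i) - 1 - C.errorProb δ i * Real.log (M i)) ≤
      ∑ s, stateProb δ s * (equivocation (fun w : (k : Fin 2) → Fin (M k) => w (other i)) -
        equivocation (erasedPrefix A (fun w => w (other i)) (C.signalOf i) s n)) := by
  refine le_trans (le_of_eq ?_) (sum_le_sum fun s _ => mul_le_mul_of_nonneg_left
    (C.log_card_le_equivocation_sub i hA s) (stateProb_nonneg hδ s))
  simp_rw [mul_sub (stateProb δ _), ← mul_assoc]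
  rw [sum_sub_distrib, ← sum_mul, ← sum_mul, ← sum_mul, sum_stateProb_mul_errorCount C hM,
    sum_stateProb]
  ring

theorem log_card_le {δ : Fin 2 → Fin 2 → ℝ} (hδ : ∀ i j, 0 ≤ δ i j ∧ δ i j ≤ 1)
    (hM : ∀ k, 0 < M k) (i : Fin 2) :
    Real.log (M i) - 1 - C.errorProb δ i * Real.log (M i) ≤ n * (1 - δ i i) * Real.log 2 := by
  have : ∀ k, Nonempty (Fin (M k)) := fun k => ⟨⟨0, hM k⟩⟩
  have hm : (0 : ℝ) < Fintype.card ((k : Fin 2) → Fin (M k)) := by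
    exact_mod_cast Fintype.card_pos
  refine le_of_mul_le_mul_left ?_ hm
  refine (C.sum_stateProb_mul_log_card_le hδ hM i (mem_singleton_self (i, i))).trans ?_
  refine (sum_le_sum fun s _ => mul_le_mul_of_nonneg_left
    (equivocation_sub_le_onCount _ (B := {(i, i)}) (s := s)
      (y := fun w => (erasedPrefix {(i, i)} (fun w => w (other i)) (C.signalOf i) s n w).2)
      fun w t ht => by simp [erasedPrefix, ht]) (stateProb_nonneg hδ s)).trans_eq ?_
  have := sum_stateProb_mul_onCount δ {(i, i)} n
  rw [prod_singleton] at this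
  rw [← this, sum_mul, mul_sum]
  exact sum_congr rfl fun s _ => by ring

theorem log_card_add_log_card_le {δ : Fin 2 → Fin 2 → ℝ} (hδ : ∀ i j, 0 ≤ δ i j ∧ δ i j ≤ 1)
    (hM : ∀ k, 0 < M k) (i : Fin 2) :
    (1 - δ i (other i)) * (Real.log (M i) - 1 - C.errorProb δ i * Real.log (M i)) +
        (1 - δ i i * δ i (other i)) * (Real.log (M (other i)) - 1 -
          C.errorProb δ (other i) * Real.log (M (other i))) ≤
      n * ((1 - δ i i * δ i (other i)) * (1 - δ (other i) (other i) * δ i (other i))) *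
        Real.log 2 := by
  have : ∀ k, Nonempty (Fin (M k)) := fun k => ⟨⟨0, hM k⟩⟩
  have hm : (0 : ℝ) < Fintype.card ((k : Fin 2) → Fin (M k)) := by
    exact_mod_cast Fintype.card_pos
  -- Decoding needs only (i,i); adding the cross link makes the link set contain {(i,ī)}, as the
  -- comparison requires.
  have h1 := C.sum_stateProb_mul_log_card_le hδ hM i (A := {(i, i), (i, other i)}) (by simp)
  have h2 := erasure_comparison hδ (A := {(i, other i)}) (A' := {(i, i), (i, other i)}) (by simp)
    (fun w : (k : Fin 2) → Fin (M k) => w (other i)) (X := C.signalOf i)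
    fun s s' t h => funext fun w => C.signal_congr w i s s' t h
  have h3 : ∑ s, stateProb δ s *
      (equivocation (fun w : (k : Fin 2) → Fin (M k) => w (other i)) -
        equivocation (erasedPrefix {(i, other i)} (fun w => w (other i)) (C.signalOf i) s n)) ≤
      Fintype.card ((k : Fin 2) → Fin (M k)) *
        (n * (1 - δ (other i) (other i) * δ i (other i)) * Real.log 2 -
          (Real.log (M (other i)) - 1) +
          C.errorProb δ (other i) * Real.log (M (other i))) := by
    refine (sum_le_sum fun s _ => mul_le_mul_of_nonneg_left
      (C.equivocation_sub_le_of_decoding hM i s) (stateProb_nonneg hδ s)).trans_eq ?_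
    have h4 := sum_stateProb_mul_onCount δ {(other i, other i), (i, other i)} n
    rw [prod_pair (by simp [other_ne i])] at h4
    rw [← h4, mul_add, ← mul_assoc _ (C.errorProb δ (other i)),
      ← sum_stateProb_mul_errorCount C hM, mul_sub, sum_mul, sum_mul, mul_sum,
      ← one_mul (_ * (Real.log _ - 1)), ← sum_stateProb δ n, sum_mul, ← sum_sub_distrib,
      ← sum_add_distrib]
    exact sum_congr rfl fun s _ => by ring
  rw [prod_singleton, prod_pair (by simp [(other_ne i).symm])] at h2
  have hb : 0 ≤ 1 - δ i (other i) := sub_nonneg.2 (hδ _ _).2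
  have hab : 0 ≤ 1 - δ i i * δ i (other i) :=
    sub_nonneg.2 (mul_le_one₀ (hδ _ _).2 (hδ _ _).1 (hδ _ _).2)
  have h5 := (mul_le_mul_of_nonneg_left h1 hb).trans
    (h2.trans (mul_le_mul_of_nonneg_left h3 hab))
  refine le_of_mul_le_mul_left ?_ hm
  simp only at h5
  linarith

end Code

end FiniteLength

/-! ### Passage to the limit -/

section Asymptotics

theorem numMessages_pos {r : ℝ} (hr : 0 ≤ r) (n : ℕ) : 0 < numMessages n r :=
  Nat.floor_pos.2 (Real.one_le_rpow one_le_two (by positivity))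

theorem log_numMessages_le {r : ℝ} (hr : 0 ≤ r) (n : ℕ) :
    Real.log (numMessages n r) ≤ n * r * Real.log 2 := by
  rw [← Real.log_rpow two_pos]
  exact Real.log_le_log (by exact_mod_cast numMessages_pos hr n) (Nat.floor_le (by positivity))

/-- Rounding down costs at most one bit, since x < ⌊x⌋ + 1 ≤ 2⌊x⌋ for x ≥ 1. -/
theorem le_log_numMessages {r : ℝ} (hr : 0 ≤ r) (n : ℕ) :
    (n * r - 1) * Real.log 2 ≤ Real.log (numMessages n r) := by
  have h1 : (1 : ℝ) ≤ numMessages n r := by exact_mod_cast numMessages_pos hr n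
  have h2 : (2 : ℝ) ^ ((n : ℝ) * r) < numMessages n r + 1 := Nat.lt_floor_add_one _
  rw [← Real.log_rpow two_pos, Real.rpow_sub two_pos, Real.rpow_one]
  exact Real.log_le_log (by positivity) (by linarith)

/-- The normalized information conveyed by a sequence of reliable codes is at least the rate. -/
theorem exists_tendsto_rate {r : ℝ} (hr : 0 ≤ r) {e : ℕ → ℝ} (he : ∀ n, 0 ≤ e n)
    (h : Tendsto e atTop (𝓝 0)) :
    ∃ a : ℕ → ℝ, Tendsto a atTop (𝓝 r) ∧ ∀ n : ℕ, 0 < n → n * Real.log 2 * a n ≤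
      Real.log (numMessages n r) - 1 - e n * Real.log (numMessages n r) := by
  have hl := Real.log_pos one_lt_two
  -- The corrections are one bit for the floor, one nat for Fano, and the decoding errors.
  refine ⟨fun n => r - (1 + (Real.log 2)⁻¹) / n - e n * r, ?_, fun n hn => ?_⟩
  · simpa using (tendsto_const_nhds.sub (tendsto_const_div_atTop_nhds_zero_nat
      (1 + (Real.log 2)⁻¹))).sub (h.mul_const r)
  · have hn' : (0 : ℝ) < n := by exact_mod_cast hn
    have h1 := le_log_numMessages hr n
    have h2 := mul_le_mul_of_nonneg_left (log_numMessages_le hr n) (he n)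
    have : n * Real.log 2 * (r - (1 + (Real.log 2)⁻¹) / n - e n * r) =
        (n * r - 1) * Real.log 2 - 1 - e n * (n * r * Real.log 2) := by
      field_simp
      ring
    linarith

theorem achievable_mem_outerRegion {δ : Fin 2 → Fin 2 → ℝ} (hδ : ∀ i j, 0 ≤ δ i j ∧ δ i j ≤ 1)
    {r : Fin 2 → ℝ} (hr : Achievable δ r) : r ∈ outerRegion δ := by
  obtain ⟨h0, C, hC⟩ := hr
  have hl := Real.log_pos one_lt_two
  have hM (n : ℕ) (k : Fin 2) : 0 < numMessages n (r k) := numMessages_pos (h0 k) n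
  choose a ha hle using fun k =>
    exists_tendsto_rate (h0 k) (fun n => (C n).errorProb_nonneg hδ k) (hC k)
  refine ⟨fun i => ⟨h0 i, ?_⟩, fun i hi => ?_⟩
  · refine le_of_tendsto (ha i) ((eventually_gt_atTop 0).mono fun n hn => ?_)
    have hn' : (0 : ℝ) < n := by exact_mod_cast hn
    have h1 := (hle i n hn).trans ((C n).log_card_le hδ (hM n) i)
    exact le_of_mul_le_mul_left (h1.trans_eq (by ring)) (mul_pos hn' hl)
  · have hb : 0 < 1 - δ i (other i) := sub_pos.2 hi
    have hab : 0 ≤ 1 - δ i i * δ i (other i) :=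
      sub_nonneg.2 (mul_le_one₀ (hδ _ _).2 (hδ _ _).1 (hδ _ _).2)
    have key : (1 - δ i (other i)) * r i + (1 - δ i i * δ i (other i)) * r (other i) ≤
        (1 - δ i i * δ i (other i)) * (1 - δ (other i) (other i) * δ i (other i)) := by
      refine le_of_tendsto (((ha i).const_mul _).add ((ha (other i)).const_mul _))
        ((eventually_gt_atTop 0).mono fun n hn => ?_)
      have hn' : (0 : ℝ) < n := by exact_mod_cast hn
      have h1 := (add_le_add (mul_le_mul_of_nonneg_left (hle i n hn) hb.le)
        (mul_le_mul_of_nonneg_left (hle (other i) n hn) hab)).trans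
        ((C n).log_card_add_log_card_le hδ (hM n) i)
      refine le_of_mul_le_mul_left ?_ (mul_pos hn' hl)
      linarith
    rw [le_div_iff₀ hb, add_mul, mul_right_comm, div_mul_cancel₀ _ hb.ne', mul_comm (r i)]
    exact key

theorem isClosed_outerRegion (δ : Fin 2 → Fin 2 → ℝ) : IsClosed (outerRegion δ) := by
  simp only [outerRegion, Set.ofPred_and, Set.ofPred_forall]
  refine IsClosed.inter (isClosed_iInter fun i => IsClosed.inter ?_ ?_)
    (isClosed_iInter fun i => isClosed_iInter fun _ => ?_)
  all_goals exact isClosed_le (by fun_prop) (by fun_prop)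

end Asymptotics

end IntermittentIC

theorem theorem1 (δ : Fin 2 → Fin 2 → ℝ) (hδ : ∀ i j, 0 ≤ δ i j ∧ δ i j ≤ 1) :
    IntermittentIC.capacityRegion δ ⊆ IntermittentIC.outerRegion δ :=
  closure_minimal (fun _ hr => IntermittentIC.achievable_mem_outerRegion hδ hr)
    (IntermittentIC.isClosed_outerRegion δ)
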